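/- Partitions are finite multisets of positive integers (the empty partition is allowed), written $\mathfrak p=[p_1\ge p_2\ge\cdots\ge p_k]$, with size $|\mathfrak p|=\sum_i p_i$. Write $\mathfrak p\sqcup\mathfrak q$ for the union of $\mathfrak p$ and $\mathfrak q$ as multisets, and $\mathfrak p+\mathfrak q=[p_1+q_1,p_2+q_2,\ldots]$ (padding with zeros), $2\mathfrak p=\mathfrak p+\mathfrak p$. Put $\mathfrak p^+=[p_1+1,p_2,\ldots,p_k]$ (so $\emptyset^+=[1]$) and $\mathfrak p^-=[p_1,\ldots,p_{k-1},p_k-1]$; write $\mathfrak p^{+-}=(\mathfrak p^+)^-$. A partition is of type $B$ if its size is odd and every even part has even multiplicity; of type $C$ if its size is even and every odd part has even multiplicity; of type $D$ if its size is even and every even part has even multiplicity. For $X\in\{B,C,D\}$ and a partition $\mathfrak p$ whose size is odd (if $X=B$) or even (if $X\in\{C,D\}$), the $X$-collapse $\mathfrak p_X$ is the largest partition of type $X$ of size $|\mathfrak p|$ that is $\le\mathfrak p$ in the dominance order. For $m,n\ge 1$ write $m=na+b$ with $0\le b<n$ and let $\mathfrak s(m;n)=[n^a,b]$ (zero parts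 are dropped). Define $$d_{com,A}^{(n)}(\mathfrak p)=\sum_{i=1}^k\mathfrak s(p_i;n),$$ $$d_{com,B}^{(n)}(\mathfrak p)=\begin{cases}(d_{com,A}^{(n)}(\mathfrak p)^+)_B& n\text{ odd},\\ (d_{com,A}^{(n/2)}(\mathfrak p)^+)_B& n\text{ even},\ n/2\text{ odd},\\ d_{com,A}^{(n/2)}(\mathfrak p)_B& n/2\text{ even},\end{cases}\qquad d_{com,C}^{(n)}(\mathfrak p)=\begin{cases}(d_{com,A}^{(n)}(\mathfrak p)^-)_C& n\text{ odd},\\ (d_{com,A}^{(n/2)}(\mathfrak p)^{+-})_C& n\text{ even},\ n/2\text{ odd},\\ d_{com,A}^{(n/2)}(\mathfrak p)_C& n/2\text{ even},\end{cases}$$ $$d_{com,D}^{(n)}(\mathfrak p)=\begin{cases}d_{com,A}^{(n)}(\mathfrak p)_D& n\text{ odd},\\ d_{com,A}^{(n/2)}(\mathfrak p)_D& n\text{ even}.\end{cases}$$ Here $d_{com,B}^{(n)}(\mathfrak p)$ is defined for $\mathfrak p$ of type $C$ if $4\nmid n$ and of type $B$ if $4\mid n$; $d_{com,C}^{(n)}(\mathfrak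 p)$ is defined for $\mathfrak p$ of type $B$ if $n$ is odd and of type $C$ if $n$ is even; $d_{com,D}^{(n)}(\mathfrak p)$ is defined for $\mathfrak p$ of type $D$. **Proposition.** Let $X,X'\in\{B,C\}$ or $X=X'=D$. Let $n$ be a positive integer and $n^*=n/\gcd(n,2)$. For any partition $\mathfrak p$ of type $X'$ such that $d_{com,X}^{(n)}(\mathfrak p)$ is defined, and any partition $\mathfrak q$, one has $$d_{com,X}^{(n)}(\mathfrak p\sqcup\mathfrak q\sqcup\mathfrak q)=\bigl(d_{com,X}^{(n)}(\mathfrak p)+2\,d_{com,A}^{(n^*)}(\mathfrak q)\bigr)_X .$$ -/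

import Mathlib

/-- An integer partition of unspecified size: a finite multiset of positive integers
(`Nat.Partition` with the size not fixed in advance). The empty partition is allowed. -/
@[ext]
structure IntPartition where
  /-- the parts, with multiplicity -/
  parts : Multiset ℕ
  parts_pos : ∀ i ∈ parts, 0 < i

namespace IntPartition

/-- The partition with the given parts; zeros are discarded. -/
def ofParts (s : Multiset ℕ) : IntPartition where
  parts := s.filter (fun i => 0 < i)
  parts_pos := fun _ hi => (Multiset.mem_filter.mp hi).2

/-- `|p|`, the sum of the parts. -/
def size (p : IntPartition) : ℕ := p.parts.sum

/-- `l(p)`, the number of parts. -/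
def length (p : IntPartition) : ℕ := p.parts.card

/-- The parts of `p` in non-increasing order. -/
def sorted (p : IntPartition) : List ℕ := p.parts.sort (fun a b => b ≤ a)

/-- `p.part i` is the `(i+1)`-st largest part of `p`, and `0` for `i ≥ l(p)`. -/
def part (p : IntPartition) (i : ℕ) : ℕ := p.sorted.getD i 0

/-- The disjoint union `p ⊔ q`: the parts of `p` and of `q` taken together. -/
def disjUnion (p q : IntPartition) : IntPartition := ofParts (p.parts + q.parts)

/-- The empty partition. -/
instance : Zero IntPartition := ⟨ofParts 0⟩

/-- The sum of partitions: the `i`-th largest parts are added for each `i`. -/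
instance : Add IntPartition :=
  ⟨fun p q => ofParts
    ((Multiset.range (max p.length q.length)).map (fun i => p.part i + q.part i))⟩

/-- `p⁺ = [p₁ + 1, p₂, …, p_k]`. -/
def plus (p : IntPartition) : IntPartition := p + ofParts {1}

/-- `p⁻ = [p₁, …, p_{k-1}, p_k - 1]` (the empty partition is left unchanged). -/
def minus (p : IntPartition) : IntPartition :=
  ofParts ((Multiset.range p.length).map
    (fun i => if i + 1 = p.length then p.part i - 1 else p.part i))

/-- The dominance order (on partitions of the same size): `q ≤ p`. -/
def Dominated (q p : IntPartition) : Prop :=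
  q.size = p.size ∧
    ∀ k : ℕ, ∑ i ∈ Finset.range k, q.part i ≤ ∑ i ∈ Finset.range k, p.part i

end IntPartition

/-- The classical types `B`, `C`, `D`. -/
inductive BCDType where
  | B
  | C
  | D

namespace IntPartition

/-- `p` is a partition of type `X`, i.e. it parametrizes nilpotent orbits of `SO_{2r+1}`
(type `B`), `Sp_{2r}` (type `C`), or `O_{2r}` (type `D`). -/
def IsOfType : BCDType → IntPartition → Prop
  | .B, p => Odd p.size ∧ ∀ i : ℕ, Even i → Even (p.parts.count i)
  | .C, p => Even p.size ∧ ∀ i : ℕ, Odd i → Even (p.parts.count i)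
  | .D, p => Even p.size ∧ ∀ i : ℕ, Even i → Even (p.parts.count i)

/-- `r` is the `X`-collapse of `p`: the largest partition of type `X` dominated by `p`. -/
def IsCollapse (X : BCDType) (p r : IntPartition) : Prop :=
  IsOfType X r ∧ Dominated r p ∧ ∀ t : IntPartition, IsOfType X t → Dominated t p → Dominated t r

open Classical in
/-- The `X`-collapse `p_X` of `p`. It exists, and is unique, exactly when `|p|` has the parity
required by type `X` (odd for `B`, even for `C` and `D`); otherwise the value is immaterial. -/
noncomputable def collapse (X : BCDType) (p : IntPartition) : IntPartition :=
  if h : ∃ r, IsCollapse X p r then h.choose else p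

/-- `s(m; n) = [n, …, n, b]`, where `m = n a + b`, `0 ≤ b < n`, and `n` occurs `a` times. -/
def euclid (m n : ℕ) : IntPartition := ofParts (Multiset.replicate (m / n) n + {m % n})

/-- The type `A` map `d_{com,A}^{(n)}([p₁, …, p_k]) = s(p₁; n) + ⋯ + s(p_k; n)`. -/
def dcomA (n : ℕ) (p : IntPartition) : IntPartition :=
  (p.sorted.map (fun m => euclid m n)).sum

/-- The maps `d_{com,X}^{(n)}` for `X = B, C, D`. -/
noncomputable def dcom : BCDType → ℕ → IntPartition → IntPartition
  | .B, n, p =>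
    if Odd n then collapse .B (dcomA n p).plus
    else if Odd (n / 2) then collapse .B (dcomA (n / 2) p).plus
    else collapse .B (dcomA (n / 2) p)
  | .C, n, p =>
    if Odd n then collapse .C (dcomA n p).minus
    else if Odd (n / 2) then collapse .C (dcomA (n / 2) p).plus.minus
    else collapse .C (dcomA (n / 2) p)
  | .D, n, p =>
    if Odd n then collapse .D (dcomA n p)
    else collapse .D (dcomA (n / 2) p)

/-- The type of the dual group of the `n`-fold cover of the group of type `X`: the domain of
`d_{com,X}^{(n)}` is the set of partitions of this type. -/
def dualType : BCDType → ℕ → BCDType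
  | .B, n => if Odd n ∨ Odd (n / 2) then .C else .B
  | .C, n => if Odd n then .B else .C
  | .D, _ => .D

/-- `d_{com,X}^{(n)}(p)` is well-defined: `p` lies in the domain of `d_{com,X}^{(n)}`. -/
def DcomDefined (X : BCDType) (n : ℕ) (p : IntPartition) : Prop := IsOfType (dualType X n) p

end IntPartition

/-! The type A map treats each part separately and sums the results, so it turns unions into sums.
With P and Q the type A images of p and q, the left side is the collapse of P + 2Q, up to the
operations plus and minus. Plus commutes with addition. It remains to see that collapsing is
insensitive to whether 2Q is added before or after an earlier collapse
(`collapse_collapse_add_self`) or before or after minus (`collapse_minus_add_self`).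

Both rest on an explicit collapse. Let S_k be the sum of the k largest parts and e = `parityShift
X`. Apart from the parity of the size, type X means that S_k + ek is even at every descent p_k >
p_{k+1} (`isOfType_iff_psum`). The collapse lowers each S_k by `defect`, which is 0 or 1 and depends
only on the parities of S_k + ek and p_k + e and on whether p_k = p_{k+1}. Adding 2Q preserves these
parities and can only destroy equalities. -/

namespace IntPartition

/-! ### Partitions as antitone sequences of parts -/

lemma length_sorted (p : IntPartition) : p.sorted.length = p.length :=
  Multiset.length_sort _

lemma part_of_length_le (p : IntPartition) {i : ℕ} (h : p.length ≤ i) : p.part i = 0 := by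
  unfold part
  exact List.getD_eq_default _ _ (by rw [length_sorted]; exact h)

lemma part_eq_getElem (p : IntPartition) {i : ℕ} (h : i < p.sorted.length) :
    p.part i = p.sorted[i] :=
  List.getD_eq_getElem _ _ h

lemma part_pos_iff (p : IntPartition) {i : ℕ} : 0 < p.part i ↔ i < p.length := by
  constructor
  · intro h
    by_contra! hi
    rw [p.part_of_length_le hi] at h
    exact absurd h (lt_irrefl 0)
  · intro h
    rw [← length_sorted] at h
    rw [part_eq_getElem p h]
    exact p.parts_pos _ ((Multiset.mem_sort (fun a b => b ≤ a)).mp (List.getElem_mem h))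

lemma part_antitone (p : IntPartition) : Antitone p.part := by
  intro i j hij
  rcases lt_or_ge j p.length with hj | hj
  · rcases hij.eq_or_lt with rfl | hlt
    · exact le_rfl
    have hj' : j < p.sorted.length := by rwa [length_sorted]
    rw [part_eq_getElem p hj', part_eq_getElem p (hlt.trans hj')]
    exact List.pairwise_iff_getElem.mp (Multiset.pairwise_sort p.parts (fun a b => b ≤ a)) i j _ _ hlt
  · rw [p.part_of_length_le hj]
    exact Nat.zero_le _

lemma sorted_eq_map_part (p : IntPartition) :
    p.sorted = (List.range p.length).map p.part := by
  apply List.ext_getElem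
  · simp [length_sorted]
  · intro i h₁ h₂
    simp [part_eq_getElem p h₁]

lemma parts_eq_map_part (p : IntPartition) :
    p.parts = (Multiset.range p.length).map p.part := by
  have h : (p.sorted : Multiset ℕ) = p.parts := Multiset.sort_eq _ _
  rw [← h, sorted_eq_map_part]
  rfl

lemma ext_part {p q : IntPartition} (h : ∀ i, p.part i = q.part i) : p = q := by
  have hl : p.length = q.length := by
    apply le_antisymm <;> by_contra! hlt
    · exact absurd (p.part_pos_iff.mpr hlt) (by rw [h, q.part_of_length_le le_rfl]; simp)
    · exact absurd (q.part_pos_iff.mpr hlt) (by rw [← h, p.part_of_length_le le_rfl]; simp)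
  ext1
  rw [parts_eq_map_part p, parts_eq_map_part q, hl]
  exact Multiset.map_congr rfl fun i _ => h i

lemma part_ofParts_map {f : ℕ → ℕ} (hf : Antitone f) {N : ℕ} (hN : ∀ i, N ≤ i → f i = 0) (i : ℕ) :
    (ofParts ((Multiset.range N).map f)).part i = f i := by
  classical
  have hex : ∃ M, f M = 0 := ⟨N, hN N le_rfl⟩
  set M := Nat.find hex with hM
  have hMz : ∀ j, M ≤ j → f j = 0 := fun j hj =>
    Nat.le_zero.mp ((hf hj).trans (Nat.find_spec hex).le)
  have hMp : ∀ j, j < M → 0 < f j := fun j hj => Nat.pos_of_ne_zero (Nat.find_min hex hj)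
  have hMN : M ≤ N := Nat.find_min' hex (hN N le_rfl)
  have hfil : (Multiset.range N).filter (fun j => 0 < f j) = Multiset.range M := by
    refine (Multiset.Nodup.ext ((Multiset.nodup_range N).filter _) (Multiset.nodup_range M)).mpr ?_
    intro j
    simp only [Multiset.mem_filter, Multiset.mem_range]
    constructor
    · rintro ⟨-, hj⟩
      by_contra! hle
      rw [hMz j hle] at hj
      exact absurd hj (lt_irrefl 0)
    · exact fun hj => ⟨hj.trans_le hMN, hMp j hj⟩
  have hparts : (ofParts ((Multiset.range N).map f)).parts = ((List.range M).map f : List ℕ) := by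
    change ((Multiset.range N).map f).filter (fun i => 0 < i) = _
    rw [Multiset.filter_map]
    change Multiset.map f ((Multiset.range N).filter (fun j => 0 < f j)) = _
    rw [hfil]
    rfl
  have hsorted : (ofParts ((Multiset.range N).map f)).sorted = (List.range M).map f := by
    refine List.Perm.eq_of_pairwise' (r := fun a b => b ≤ a) (Multiset.pairwise_sort _ _) ?_ ?_
    · rw [List.pairwise_map]
      exact List.pairwise_lt_range.imp fun h => hf h.le
    · rw [← Multiset.coe_eq_coe, ← hparts]
      exact Multiset.sort_eq _ _
  unfold part
  rw [hsorted]
  rcases lt_or_ge i M with hi | hi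
  · rw [List.getD_eq_getElem _ _ (by simpa using hi)]
    simp
  · rw [List.getD_eq_default _ _ (by simpa using hi), hMz i hi]

lemma part_add (p q : IntPartition) (i : ℕ) : (p + q).part i = p.part i + q.part i := by
  refine part_ofParts_map (f := fun i => p.part i + q.part i)
    (p.part_antitone.add q.part_antitone) ?_ i
  intro j hj
  rw [p.part_of_length_le (le_of_max_le_left hj), q.part_of_length_le (le_of_max_le_right hj)]

lemma part_zero_partition (i : ℕ) : (0 : IntPartition).part i = 0 :=
  part_of_length_le _ (Nat.zero_le i)

lemma part_list_sum (l : List IntPartition) (i : ℕ) :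
    l.sum.part i = (l.map (fun p => p.part i)).sum := by
  induction l with
  | nil => exact part_zero_partition i
  | cons p l ih => rw [List.sum_cons, part_add, ih, List.map_cons, List.sum_cons]

lemma part_minus (p : IntPartition) (i : ℕ) :
    p.minus.part i = if i + 1 = p.length then p.part i - 1 else p.part i := by
  refine part_ofParts_map
    (f := fun i => if i + 1 = p.length then p.part i - 1 else p.part i) ?_ ?_ i
  · refine antitone_nat_of_succ_le fun j => ?_
    have h := p.part_antitone (Nat.le_succ j)
    have h' : j + 1 = p.length → p.part (j + 1) = 0 := fun hj => p.part_of_length_le hj.ge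
    simp only [Nat.succ_eq_add_one] at h
    split_ifs <;> grind
  · intro j hj
    have := p.part_of_length_le hj
    simp [this]

/-! ### Partial sums and sizes -/

/-- The sum of the `k` largest parts. -/
def psum (p : IntPartition) (k : ℕ) : ℕ := ∑ i ∈ Finset.range k, p.part i

@[simp] lemma psum_zero (p : IntPartition) : p.psum 0 = 0 := rfl

lemma psum_succ (p : IntPartition) (k : ℕ) : p.psum (k + 1) = p.psum k + p.part k :=
  Finset.sum_range_succ _ _

lemma psum_add (p q : IntPartition) (k : ℕ) : (p + q).psum k = p.psum k + q.psum k := by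
  simp only [psum, part_add, Finset.sum_add_distrib]

lemma psum_length (p : IntPartition) : p.psum p.length = p.size := by
  rw [size, parts_eq_map_part]
  rfl

lemma psum_of_length_le (p : IntPartition) {k : ℕ} (h : p.length ≤ k) : p.psum k = p.size := by
  induction k, h using Nat.le_induction with
  | base => exact p.psum_length
  | succ k hk ih => rw [psum_succ, ih, p.part_of_length_le hk, add_zero]

lemma ext_psum {p q : IntPartition} (h : ∀ k, p.psum k = q.psum k) : p = q := by
  refine ext_part fun i => ?_
  have := h (i + 1)
  rw [psum_succ, psum_succ, h i] at this
  exact Nat.add_left_cancel this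

lemma size_add (p q : IntPartition) : (p + q).size = p.size + q.size := by
  set N := max (p + q).length (max p.length q.length)
  rw [← (p + q).psum_of_length_le (k := N) (le_max_left _ _),
    ← p.psum_of_length_le (k := N) ((le_max_left _ _).trans (le_max_right _ _)),
    ← q.psum_of_length_le (k := N) ((le_max_right _ _).trans (le_max_right _ _)), psum_add]

lemma size_ofParts (s : Multiset ℕ) : (ofParts s).size = s.sum := by
  change (s.filter (fun i => 0 < i)).sum = s.sum
  conv_rhs => rw [← Multiset.filter_add_not (fun i => 0 < i) s]
  rw [Multiset.sum_add, Multiset.sum_eq_zero (s := s.filter fun i => ¬ 0 < i), add_zero]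
  intro x hx
  simpa using (Multiset.mem_filter.mp hx).2

/-! ### Additivity of the type A map -/

lemma size_euclid (m n : ℕ) : (euclid m n).size = m := by
  rw [euclid, size_ofParts]
  simp [Nat.div_add_mod']

lemma part_dcomA (n : ℕ) (p : IntPartition) (i : ℕ) :
    (dcomA n p).part i = (p.parts.map (fun m => (euclid m n).part i)).sum := by
  have h : (p.sorted : Multiset ℕ) = p.parts := Multiset.sort_eq _ _
  rw [dcomA, part_list_sum, ← h, List.map_map, Multiset.map_coe, Multiset.sum_coe]
  rfl

lemma dcomA_disjUnion (n : ℕ) (p q : IntPartition) :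
    dcomA n (p.disjUnion q) = dcomA n p + dcomA n q := by
  refine ext_part fun i => ?_
  have h : (p.disjUnion q).parts = p.parts + q.parts :=
    Multiset.filter_eq_self.mpr fun a ha =>
      (Multiset.mem_add.mp ha).elim (p.parts_pos a) (q.parts_pos a)
  rw [part_add, part_dcomA, part_dcomA, part_dcomA, h, Multiset.map_add, Multiset.sum_add]

lemma size_list_sum (l : List IntPartition) : l.sum.size = (l.map size).sum := by
  induction l with
  | nil => rfl
  | cons p l ih => rw [List.sum_cons, size_add, ih, List.map_cons, List.sum_cons]

lemma size_dcomA (n : ℕ) (p : IntPartition) : (dcomA n p).size = p.size := by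
  have h : (p.sorted : Multiset ℕ) = p.parts := Multiset.sort_eq _ _
  rw [dcomA, size_list_sum, size, ← h, List.map_map, Multiset.sum_coe]
  congr 1
  conv_rhs => rw [← List.map_id p.sorted]
  exact List.map_congr_left fun m _ => size_euclid m n

lemma size_plus (p : IntPartition) : p.plus.size = p.size + 1 := by
  rw [plus, size_add, size_ofParts, Multiset.sum_singleton]

lemma add_assoc' (p q r : IntPartition) : p + q + r = p + (q + r) :=
  ext_part fun i => by simp only [part_add, Nat.add_assoc]

lemma plus_add (p q : IntPartition) : (p + q).plus = p.plus + q :=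
  ext_part fun i => by simp only [plus, part_add, Nat.add_right_comm]

/-! ### Types in terms of partial sums -/

/-- The integer `e` such that `p` has type `X` if and only if `|p|` has the right parity and every
part `i` with `i + e` odd has even multiplicity. -/
def parityShift : BCDType → ℕ
  | .B => 1
  | .C => 0
  | .D => 1

/-- The parity of the size of a partition of type `X`. -/
def SizeParity : BCDType → ℕ → Prop
  | .B, m => Odd m
  | .C, m => Even m
  | .D, m => Even m

lemma isOfType_iff_count (X : BCDType) (p : IntPartition) :
    p.IsOfType X ↔ SizeParity X p.size ∧
      ∀ i, Odd (i + parityShift X) → Even (p.parts.count i) := by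
  cases X <;> simp [IsOfType, SizeParity, parityShift, Nat.odd_add_one]

lemma even_sum_map_of_even_count {s : Multiset ℕ} {e : ℕ}
    (h : ∀ i ∈ s, Odd (i + e) → Even (s.count i)) : Even (s.map (· + e)).sum := by
  rw [Finset.sum_multiset_map_count]
  refine Finset.even_sum _ fun i hi => ?_
  rw [smul_eq_mul, Nat.even_mul]
  by_cases ho : Odd (i + e)
  · exact Or.inl (h i (Multiset.mem_toFinset.mp hi) ho)
  · exact Or.inr (Nat.not_odd_iff_even.mp ho)

lemma psum_add_mul (p : IntPartition) (e k : ℕ) :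
    p.psum k + e * k = (((Multiset.range k).map p.part).map (· + e)).sum := by
  rw [Multiset.map_map]
  change _ = ∑ i ∈ Finset.range k, (p.part i + e)
  rw [Finset.sum_add_distrib, Finset.sum_const, Finset.card_range, smul_eq_mul, mul_comm]
  rfl

lemma count_map_part (p : IntPartition) (k i : ℕ) :
    ((Multiset.range k).map p.part).count i =
      ((Finset.range k).filter (fun j => i = p.part j)).card := by
  rw [Multiset.count_map]
  rfl

/-- A partition has type `X` exactly when its size has the right parity and all partial sums at
descents satisfy a parity condition. -/
lemma isOfType_iff_psum (X : BCDType) (p : IntPartition) :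
    p.IsOfType X ↔ SizeParity X p.size ∧
      ∀ k, p.part (k + 1) < p.part k → Even (p.psum (k + 1) + parityShift X * (k + 1)) := by
  rw [isOfType_iff_count]
  refine and_congr_right fun hs => ⟨fun h k hk => ?_, fun h v hv => ?_⟩
  · rw [psum_add_mul]
    -- A descent at `k` means that each value among the first `k + 1` parts occurs there with its
    -- full multiplicity.
    refine even_sum_map_of_even_count fun i hi ho => ?_
    convert h i ho using 1
    rw [parts_eq_map_part, count_map_part, count_map_part]
    obtain ⟨j, hj, rfl⟩ := Multiset.mem_map.mp hi
    rw [Multiset.mem_range] at hj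
    congr 1
    ext l
    simp only [Finset.mem_filter, Finset.mem_range]
    have h1 : p.part k ≤ p.part j := p.part_antitone (Nat.lt_succ_iff.mp hj)
    constructor
    · rintro ⟨hl, he⟩
      exact ⟨p.part_pos_iff.mp (by omega), he⟩
    · rintro ⟨hl, he⟩
      refine ⟨?_, he⟩
      by_contra! hle
      have := p.part_antitone hle
      omega
  · rcases Nat.eq_zero_or_pos v with rfl | hpos
    · rw [Multiset.count_eq_zero.mpr fun h0 => absurd (p.parts_pos 0 h0) (lt_irrefl 0)]
      exact Even.zero
    by_cases hmem : v ∈ p.parts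
    swap
    · rw [Multiset.count_eq_zero.mpr hmem]
      exact Even.zero
    -- The parts equal to `v` are those with index in `[a, b)`. Both ends are descents or 0, and
    -- across the block S_k + ek grows by `(b - a) * (v + e)`, with `v + e` odd.
    have hex : ∃ b, p.part b < v := ⟨p.length, by rwa [p.part_of_length_le le_rfl]⟩
    have hex' : ∃ a, p.part a ≤ v := ⟨p.length, by rw [p.part_of_length_le le_rfl]; exact hpos.le⟩
    set a := Nat.find hex' with ha
    set b := Nat.find hex with hb
    have ha1 : ∀ j, p.part j ≤ v ↔ a ≤ j := fun j =>
      ⟨fun hj => Nat.find_min' hex' hj, fun hj => (p.part_antitone hj).trans (Nat.find_spec hex')⟩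
    have hb1 : ∀ j, p.part j < v ↔ b ≤ j := fun j =>
      ⟨fun hj => Nat.find_min' hex hj,
        fun hj => (p.part_antitone hj).trans_lt (Nat.find_spec hex)⟩
    have hab : a ≤ b := (ha1 b).mp ((hb1 b).mpr le_rfl).le
    have hbl : b ≤ p.length := (hb1 _).mp (by rwa [p.part_of_length_le le_rfl])
    have hcount : p.parts.count v = b - a := by
      rw [parts_eq_map_part, count_map_part, ← Nat.card_Ico]
      congr 1
      ext j
      have h1 := ha1 j
      have h2 := hb1 j
      simp only [Finset.mem_filter, Finset.mem_range, Finset.mem_Ico]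
      omega
    have heven : ∀ c, (∀ j, j + 1 = c → p.part c < p.part j) →
        Even (p.psum c + parityShift X * c) := by
      intro c hc
      cases c with
      | zero => simp
      | succ c => exact h c (hc c rfl)
    have hEa := heven a fun j hj => by
      have h1 := ha1 j
      have h2 := ha1 a
      omega
    have hEb := heven b fun j hj => by
      have h1 := hb1 j
      have h2 := hb1 b
      omega
    have hsum : ∀ m, a + m ≤ b → p.psum (a + m) + parityShift X * (a + m) =
        p.psum a + parityShift X * a + m * (v + parityShift X) := by
      intro m
      induction m with
      | zero => simp
      | succ m ih =>
        intro hm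
        have hv' : p.part (a + m) = v := by
          have h1 := ha1 (a + m)
          have h2 := hb1 (a + m)
          omega
        rw [← add_assoc a m 1, psum_succ, hv']
        linear_combination ih (by omega)
    have := hsum (b - a) (by omega)
    rw [Nat.add_sub_cancel' hab] at this
    rw [this, Nat.even_add, iff_true_left hEa, Nat.even_mul] at hEb
    rw [hcount]
    exact hEb.resolve_right (Nat.not_even_iff_odd.mpr hv)

/-! ### The closed form of the collapse -/

/-- The amount by which the `k`-th partial sum of `p` drops in its collapse. -/
def defect (e : ℕ) (p : IntPartition) : ℕ → ℕ
  | 0 => 0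
  | k + 1 =>
    -- An odd value is harmless inside a block of equal parts with `part + e` odd, where parities
    -- alternate. If `part + e` is even, the parity is constant along the block, so the whole
    -- stretch must drop.
    if Odd (p.psum (k + 1) + e * (k + 1)) ∧ ¬ (p.part k = p.part (k + 1) ∧ Odd (p.part k + e))
    then 1 else 0

lemma defect_of_length_lt {X : BCDType} {p : IntPartition} (hp : SizeParity X p.size) {k : ℕ}
    (hk : p.length < k) : defect (parityShift X) p k = 0 := by
  obtain ⟨k, rfl⟩ := Nat.exists_eq_succ_of_ne_zero (Nat.ne_zero_of_lt hk)
  rw [Nat.succ_eq_add_one] at hk ⊢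
  have h1 := p.part_of_length_le (Nat.lt_succ_iff.mp hk)
  have h2 := p.part_of_length_le hk.le
  have h3 := p.psum_of_length_le hk.le
  rw [defect, h1, h2, h3]
  cases X
  · simp [parityShift]
  · have : Even p.size := hp
    simp [parityShift, this]
  · simp [parityShift]

/-- This is monotonicity of the collapsed parts, rearranged to avoid subtraction. Suppose the middle
defect is 1. If the two parts are equal, `part + e` is even and both neighbouring defects are 1; if
they differ by 1, one of them has `part + e` even and the defect on its side is 1. -/
lemma antitone_part_defect (e : ℕ) (p : IntPartition) (i : ℕ) :
    p.part (i + 1) + defect e p (i + 1) + defect e p (i + 1) ≤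
      p.part i + defect e p i + defect e p (i + 2) := by
  have h1 := p.part_antitone (Nat.le_succ i)
  have h2 := p.psum_succ i
  have h3 := p.psum_succ (i + 1)
  have e3 : e * (i + 1 + 1) = e * i + e + e := by ring
  have e2 : e * (i + 1) = e * i + e := by ring
  cases i with
  | zero =>
    simp only [defect, psum_zero, Nat.odd_iff, Nat.succ_eq_add_one] at *
    split_ifs <;> grind
  | succ i =>
    have h4 := p.psum_succ i
    have h5 := p.part_antitone (Nat.le_succ i)
    have e1 : e * (i + 1) = e * i + e := by ring
    simp only [defect, Nat.odd_iff, Nat.succ_eq_add_one] at *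
    split_ifs <;> grind

/-- The closed form of the `X`-collapse. -/
def collapseForm (X : BCDType) (p : IntPartition) : IntPartition :=
  -- For types B and D the defect at `p.length` can be 1, which creates one new part.
  ofParts ((Multiset.range (p.length + 1)).map fun i =>
    p.part i + defect (parityShift X) p i - defect (parityShift X) p (i + 1))

lemma defect_le_one (e : ℕ) (p : IntPartition) (k : ℕ) : defect e p k ≤ 1 := by
  cases k with
  | zero => exact Nat.zero_le _
  | succ k => rw [defect]; split_ifs <;> simp

lemma defect_succ_le {X : BCDType} {p : IntPartition} (hp : SizeParity X p.size) (i : ℕ) :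
    defect (parityShift X) p (i + 1) ≤ p.part i + defect (parityShift X) p i := by
  rcases lt_or_ge i p.length with h | h
  · have := p.part_pos_iff.mpr h
    have := defect_le_one (parityShift X) p (i + 1)
    omega
  · rw [defect_of_length_lt hp (Nat.lt_succ_of_le h)]
    exact Nat.zero_le _

lemma part_collapseForm {X : BCDType} {p : IntPartition} (hp : SizeParity X p.size) (i : ℕ) :
    (collapseForm X p).part i + defect (parityShift X) p (i + 1) =
      p.part i + defect (parityShift X) p i := by
  have h : (collapseForm X p).part i =
      p.part i + defect (parityShift X) p i - defect (parityShift X) p (i + 1) := by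
    refine part_ofParts_map (f := fun i =>
      p.part i + defect (parityShift X) p i - defect (parityShift X) p (i + 1)) ?_ ?_ i
    · refine antitone_nat_of_succ_le fun j => ?_
      have h1 := antitone_part_defect (parityShift X) p j
      have h2 := defect_succ_le hp j
      have h3 := defect_succ_le hp (j + 1)
      simp only [add_assoc, Nat.reduceAdd] at *
      omega
    · intro j hj
      have h1 := p.part_of_length_le (Nat.le_of_succ_le hj)
      have h2 := defect_of_length_lt hp (Nat.lt_of_succ_le hj)
      simp [h1, h2]
  have := defect_succ_le hp i
  omega

lemma psum_collapseForm {X : BCDType} {p : IntPartition} (hp : SizeParity X p.size) (k : ℕ) :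
    (collapseForm X p).psum k + defect (parityShift X) p k = p.psum k := by
  induction k with
  | zero => rfl
  | succ k ih =>
    have := part_collapseForm hp k
    rw [psum_succ, psum_succ]
    omega

lemma size_eq_of_psum_eventually {p q : IntPartition} {N : ℕ}
    (h : ∀ k, N ≤ k → p.psum k = q.psum k) : p.size = q.size := by
  rw [← p.psum_of_length_le (k := max N (max p.length q.length)) (by simp),
    ← q.psum_of_length_le (k := max N (max p.length q.length)) (by simp), h _ (le_max_left _ _)]

lemma size_collapseForm {X : BCDType} {p : IntPartition} (hp : SizeParity X p.size) :
    (collapseForm X p).size = p.size :=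
  size_eq_of_psum_eventually (N := p.length + 1) fun k hk => by
    rw [← psum_collapseForm hp k, defect_of_length_lt hp (Nat.lt_of_succ_le hk), add_zero]

/-- A defect of 1 makes the partial sum even after the shift. If the shifted sum is odd with defect
0, the adjacent parts are equal with `part + e` odd, so the neighbouring shifted sums are even,
their defects vanish, and the collapse has no descent there. -/
lemma isOfType_collapseForm {X : BCDType} {p : IntPartition} (hp : SizeParity X p.size) :
    (collapseForm X p).IsOfType X := by
  rw [isOfType_iff_psum, size_collapseForm hp]
  refine ⟨hp, fun k hk => ?_⟩
  have h1 := psum_collapseForm hp (k + 1)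
  have h2 := part_collapseForm hp k
  have h3 := part_collapseForm hp (k + 1)
  have h4 := p.psum_succ k
  have h5 := p.psum_succ (k + 1)
  generalize parityShift X = e at *
  have e3 : e * (k + 1 + 1) = e * k + e + e := by ring
  have e2 : e * (k + 1) = e * k + e := by ring
  cases k with
  | zero =>
    simp only [defect, psum_zero, Nat.odd_iff, Nat.even_iff] at *
    split_ifs at * <;> grind
  | succ k =>
    simp only [defect, Nat.odd_iff, Nat.even_iff] at *
    split_ifs at * <;> grind

/-! ### Maximality and uniqueness of the collapse -/

/-- A partition of type `X` dominated by `p` cannot reach the partial sums of `p` at positions of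
positive defect. -/
lemma defect_eq_zero_of_psum_eq {X : BCDType} {p t : IntPartition} (ht : t.IsOfType X)
    (hle : ∀ k, t.psum k ≤ p.psum k) {k : ℕ} (hk : t.psum k = p.psum k) :
    defect (parityShift X) p k = 0 := by
  have htype := ((isOfType_iff_psum X t).mp ht).2
  induction k with
  | zero => rfl
  | succ k ih =>
    have h0 := htype k
    have h1 := t.part_antitone (Nat.le_succ k)
    have h1' := p.part_antitone (Nat.le_succ k)
    have h2 := hle k
    have h3 := hle (k + 1 + 1)
    have h4 := p.psum_succ k
    have h5 := p.psum_succ (k + 1)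
    have h6 := t.psum_succ k
    have h7 := t.psum_succ (k + 1)
    generalize parityShift X = e at *
    have e2 : e * (k + 1) = e * k + e := by ring
    simp only [Nat.succ_eq_add_one] at *
    rw [defect, if_neg]
    rintro ⟨hodd, hne⟩
    have hteq : t.part (k + 1) = t.part k := by
      by_contra hc
      have := h0 (by omega)
      rw [hk] at this
      exact Nat.not_even_iff_odd.mpr hodd this
    -- The partial sums of `p` lie above those of `t` and touch them at `k + 1`, so `p.part k ≤
    -- t.part k = t.part (k + 1) ≤ p.part (k + 1)`. All four parts coincide, and the sums also touch
    -- at `k`.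
    have hpeq : p.part k = p.part (k + 1) := by omega
    have hpt : p.part k = t.part k := by omega
    have hev : ¬ Odd (p.part k + e) := fun h => hne ⟨hpeq, h⟩
    have ih' := ih (by omega)
    -- As `p.part k + e` is even, the odd parity passes down to `k` and forces defect 1 there,
    -- against `ih'`; at 0 the empty sum is even.
    cases k with
    | zero => simp [psum_succ, hev] at hodd
    | succ k =>
      have e1 : e * (k + 1) = e * k + e := by ring
      simp only [defect, Nat.odd_iff] at *
      split_ifs at ih'
      grind

lemma isCollapse_collapseForm {X : BCDType} {p : IntPartition} (hp : SizeParity X p.size) :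
    IsCollapse X p (collapseForm X p) := by
  refine ⟨isOfType_collapseForm hp, ⟨size_collapseForm hp, fun k => ?_⟩, ?_⟩
  · exact (Nat.le_add_right _ _).trans_eq (psum_collapseForm hp k)
  · rintro t ht ⟨hsize, hle⟩
    refine ⟨hsize.trans (size_collapseForm hp).symm, fun k => ?_⟩
    change t.psum k ≤ (collapseForm X p).psum k
    have h1 : t.psum k ≤ p.psum k := hle k
    have h2 := psum_collapseForm hp k
    have h3 := defect_le_one (parityShift X) p k
    rcases h1.eq_or_lt with h | h
    · have := defect_eq_zero_of_psum_eq ht hle h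
      omega
    · omega

lemma IsCollapse.unique {X : BCDType} {p r s : IntPartition} (hr : IsCollapse X p r)
    (hs : IsCollapse X p s) : r = s :=
  ext_psum fun k => le_antisymm ((hs.2.2 r hr.1 hr.2.1).2 k) ((hr.2.2 s hs.1 hs.2.1).2 k)

lemma collapse_eq_collapseForm {X : BCDType} {p : IntPartition} (hp : SizeParity X p.size) :
    collapse X p = collapseForm X p := by
  have h : ∃ r, IsCollapse X p r := ⟨_, isCollapse_collapseForm hp⟩
  rw [collapse, dif_pos h]
  exact h.choose_spec.unique (isCollapse_collapseForm hp)

/-! ### Collapsing and adding 2q -/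

lemma sizeParity_add_self {X : BCDType} {p : IntPartition} (hp : SizeParity X p.size)
    (q : IntPartition) : SizeParity X (p + (q + q)).size := by
  rw [size_add, size_add]
  cases X <;> simp only [SizeParity] at * <;> grind

/-- Collapsing commutes with adding `2q`. -/
lemma collapse_collapse_add_self {X : BCDType} {p : IntPartition} (hp : SizeParity X p.size)
    (q : IntPartition) : collapse X (collapse X p + (q + q)) = collapse X (p + (q + q)) := by
  have hc : SizeParity X (collapseForm X p).size := by rwa [size_collapseForm hp]
  have h1 := sizeParity_add_self hp q
  have h2 := sizeParity_add_self hc q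
  rw [collapse_eq_collapseForm hp, collapse_eq_collapseForm h1, collapse_eq_collapseForm h2]
  -- The two successive defects add up to the defect of `p + 2q`. If `p` has defect 1, so does `p +
  -- 2q`, and the second collapse finds an even sum. If `p` has defect 0 with odd shifted sum, the
  -- neighbouring defects vanish, so both adjacent parts survive the first collapse unchanged.
  refine ext_psum fun k => ?_
  have g1 := psum_collapseForm h1 k
  have g2 := psum_collapseForm h2 k
  have g3 := psum_collapseForm hp k
  cases k with
  | zero => rfl
  | succ k =>
    have a1 := part_collapseForm hp k
    have a2 := part_collapseForm hp (k + 1)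
    have a3 := q.part_antitone (Nat.le_succ k)
    have a4 := p.part_antitone (Nat.le_succ k)
    have a5 := p.psum_succ k
    have a6 := p.psum_succ (k + 1)
    have a7 := (collapseForm X p).part_antitone (Nat.le_succ k)
    simp only [psum_add, part_add, defect] at *
    generalize parityShift X = e at *
    have e3 : e * (k + 1 + 1) = e * k + e + e := by ring
    have e2 : e * (k + 1) = e * k + e := by ring
    cases k with
    | zero =>
      simp only [psum_zero, Nat.odd_iff, Nat.succ_eq_add_one] at *
      split_ifs at * <;> grind
    | succ k =>
      simp only [Nat.odd_iff, Nat.succ_eq_add_one] at *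
      split_ifs at * <;> grind

/-! ### The operation minus and type C -/

lemma length_add (p q : IntPartition) : (p + q).length = max p.length q.length := by
  refine le_antisymm ?_ (max_le ?_ ?_) <;> by_contra! h
  · have h1 := (p + q).part_pos_iff.mpr h
    rw [part_add, p.part_of_length_le (le_max_left _ _),
      q.part_of_length_le (le_max_right _ _)] at h1
    exact absurd h1 (lt_irrefl 0)
  · have h1 := p.part_pos_iff.mpr h
    have h2 := (p + q).part_of_length_le le_rfl
    rw [part_add] at h2
    omega
  · have h1 := q.part_pos_iff.mpr h
    have h2 := (p + q).part_of_length_le le_rfl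
    rw [part_add] at h2
    omega

lemma length_pos_of_size_pos {p : IntPartition} (h : 0 < p.size) : 0 < p.length := by
  by_contra! h0
  rw [← p.psum_length, Nat.le_zero.mp h0] at h
  exact absurd h (lt_irrefl 0)

lemma psum_minus {p : IntPartition} (hp : 0 < p.length) (k : ℕ) :
    p.minus.psum k + (if p.length ≤ k then 1 else 0) = p.psum k := by
  induction k with
  | zero => simp [hp.ne']
  | succ k ih =>
    have := p.part_pos_iff (i := k)
    rw [psum_succ, psum_succ, part_minus]
    split_ifs at * <;> omega

lemma size_minus {p : IntPartition} (hp : 0 < p.size) : p.minus.size + 1 = p.size := by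
  have hl := length_pos_of_size_pos hp
  have h1 := psum_minus hl (max p.length p.minus.length)
  rwa [if_pos (le_max_left _ _), psum_of_length_le _ (le_max_right _ _),
    psum_of_length_le _ (le_max_left _ _)] at h1

lemma even_size_minus {p : IntPartition} (hp : Odd p.size) : SizeParity .C p.minus.size := by
  have h := size_minus hp.pos
  rw [← h, Nat.odd_add_one, Nat.not_odd_iff_even] at hp
  exact hp

/-- For `p` of odd size, `(p + 2q)⁻` and `p⁻ + 2q` have the same `C`-collapse. -/
lemma collapse_minus_add_self {p : IntPartition} (hp : Odd p.size) (q : IntPartition) :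
    collapse .C (p + (q + q)).minus = collapse .C (p.minus + (q + q)) := by
  have hl := length_pos_of_size_pos hp.pos
  have hm := length_add p (q + q)
  rw [length_add q q, max_self] at hm
  rcases le_or_gt q.length p.length with hqp | hqp
  · rw [max_eq_left hqp] at hm
    -- Here both sides decrease the same last part, so the partitions agree before collapsing.
    congr 1
    refine ext_part fun i => ?_
    have := p.part_pos_iff (i := i)
    simp only [part_minus, part_add, hm]
    split_ifs <;> omega
  rw [max_eq_right hqp.le] at hm
  have hl' : 0 < (p + (q + q)).length := by omega
  have hodd : Odd (p + (q + q)).size := sizeParity_add_self (X := .B) hp q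
  have h1 := even_size_minus hodd
  have h2 := sizeParity_add_self (even_size_minus hp) q
  rw [collapse_eq_collapseForm h1, collapse_eq_collapseForm h2]
  refine ext_psum fun k => ?_
  have g1 := psum_collapseForm h1 k
  have g2 := psum_collapseForm h2 k
  cases k with
  | zero => rfl
  | succ k =>
    have a1 := psum_minus hl (k + 1)
    have a2 := psum_minus hl' (k + 1)
    have a3 := q.part_antitone (Nat.le_succ k)
    have a4 := p.part_antitone (Nat.le_succ k)
    have a5 := p.psum_succ k
    have a6 := p.psum_succ (k + 1)
    have b1 := p.part_pos_iff (i := k)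
    have b2 := p.part_pos_iff (i := k + 1)
    have b3 := q.part_pos_iff (i := k)
    have b4 := q.part_pos_iff (i := k + 1)
    have c0 : p.length ≤ k → p.psum k = p.size := p.psum_of_length_le
    have c1 : p.length ≤ k + 1 → p.psum (k + 1) = p.size := p.psum_of_length_le
    have c2 : p.length ≤ k + 1 + 1 → p.psum (k + 1 + 1) = p.size := p.psum_of_length_le
    simp only [psum_add, part_add, part_minus, defect, hm, parityShift, zero_mul, add_zero,
      Nat.odd_iff, Nat.succ_eq_add_one] at *
    clear h1 h2 hl' hodd
    generalize p.length = a at *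
    generalize q.length = m at *
    -- From `a` up to but excluding `m`, the sums of `(p + 2q)⁻` are odd because `|p|` is, and the
    -- parts beyond `p` are even, so the defect is 1. This matches the unit already removed in `p⁻ +
    -- 2q`, whose sums there are even.
    rcases lt_trichotomy (k + 1) a with h | h | h
    · rw [if_neg (by omega)] at a1 a2
      split_ifs at * <;> omega
    · rw [if_pos (by omega)] at a1
      split_ifs at * <;> omega
    · rw [if_pos (by omega)] at a1
      split_ifs at * <;> omega

end IntPartition

/-! ### Assembling the types B, C and D -/

open IntPartition in
theorem mainTheorem7 (X X' : BCDType)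
    (hX : ((X = .B ∨ X = .C) ∧ (X' = .B ∨ X' = .C)) ∨ (X = .D ∧ X' = .D))
    (n : ℕ) (hn : 0 < n) (p q : IntPartition)
    (hp : p.IsOfType X') (hdef : IntPartition.DcomDefined X n p) :
    IntPartition.dcom X n ((p.disjUnion q).disjUnion q) =
      IntPartition.collapse X
        (IntPartition.dcom X n p +
          (IntPartition.dcomA (n / Nat.gcd n 2) q + IntPartition.dcomA (n / Nat.gcd n 2) q)) := by
  have hunion : ∀ m, dcomA m ((p.disjUnion q).disjUnion q) =
      dcomA m p + (dcomA m q + dcomA m q) := fun m => by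
    rw [dcomA_disjUnion, dcomA_disjUnion, add_assoc']
  have hsize : SizeParity (dualType X n) p.size := ((isOfType_iff_count _ _).mp hdef).1
  have hgcd_odd : Odd n → n / Nat.gcd n 2 = n := fun h => by
    rw [Nat.Coprime.gcd_eq_one (Nat.coprime_two_right.mpr h), Nat.div_one]
  have hgcd_even : ¬ Odd n → n / Nat.gcd n 2 = n / 2 := fun h => by
    rw [Nat.gcd_eq_right (Nat.not_odd_iff_even.mp h).two_dvd]
  cases X with
  | B =>
    simp only [dcom, hunion]
    by_cases h : Odd n
    · have hs : SizeParity .B (dcomA n p).plus.size := by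
        rw [size_plus, size_dcomA]
        simp only [dualType, h, true_or, if_true, SizeParity] at hsize
        exact hsize.add_one
      rw [if_pos h, if_pos h, hgcd_odd h, plus_add, collapse_collapse_add_self hs]
    rw [if_neg h, if_neg h, hgcd_even h]
    by_cases h2 : Odd (n / 2)
    · have hs : SizeParity .B (dcomA (n / 2) p).plus.size := by
        rw [size_plus, size_dcomA]
        simp only [dualType, h2, or_true, if_true, SizeParity] at hsize
        exact hsize.add_one
      rw [if_pos h2, if_pos h2, plus_add, collapse_collapse_add_self hs]
    · have hs : SizeParity .B (dcomA (n / 2) p).size := by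
        rw [size_dcomA]
        simpa only [dualType, h, h2, or_self, if_false] using hsize
      rw [if_neg h2, if_neg h2, collapse_collapse_add_self hs]
  | C =>
    simp only [dcom, hunion]
    by_cases h : Odd n
    · have hs : Odd (dcomA n p).size := by
        rw [size_dcomA]
        simp only [dualType, h, if_true] at hsize
        exact hsize
      rw [if_pos h, if_pos h, hgcd_odd h, collapse_minus_add_self hs,
        collapse_collapse_add_self (even_size_minus hs)]
    rw [if_neg h, if_neg h, hgcd_even h]
    simp only [dualType, h, if_false, SizeParity] at hsize
    by_cases h2 : Odd (n / 2)
    · have hs : Odd (dcomA (n / 2) p).plus.size := by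
        rw [size_plus, size_dcomA]
        exact hsize.add_one
      rw [if_pos h2, if_pos h2, plus_add, collapse_minus_add_self hs,
        collapse_collapse_add_self (even_size_minus hs)]
    · have hs : SizeParity .C (dcomA (n / 2) p).size := by
        rwa [size_dcomA]
      rw [if_neg h2, if_neg h2, collapse_collapse_add_self hs]
  | D =>
    have hs : ∀ m, SizeParity .D (dcomA m p).size := fun m => by
      rwa [size_dcomA]
    simp only [dcom, hunion]
    by_cases h : Odd n
    · rw [if_pos h, if_pos h, hgcd_odd h, collapse_collapse_add_self (hs n)]
    · rw [if_neg h, if_neg h, hgcd_even h, collapse_collapse_add_self (hs (n / 2))]
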